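/- **Setting.** Let $\mathcal P$ be a finite set of processes, and let $\mathcal B$ be the set of Byzantine nodes; $\mathcal W=\mathcal P\setminus\mathcal B$ is the set of well-behaved processes. There is a designated sender $s$, which is either a process of $\mathcal P$ or a separate node, and which may be Byzantine or well-behaved. A heterogeneous quorum system $\mathcal Q$ assigns to every process $p$ a non-empty set $\mathcal Q(p)$ of non-empty subsets of $\mathcal P$, none of which properly contains another (the individual minimal quorums of $p$); the quorums of Byzantine processes are arbitrary. - $\mathcal Q$ has *quorum intersection* if $q\cap q'\cap\mathcal W\neq\emptyset$ for all $p,p'\in\mathcal W$, $q\in\mathcal Q(p)$, $q'\in\mathcal Q(p')$. - A quorum $q$ is *complete* if $q\subseteq\mathcal W$ and every $p\in q$ has a quorum $q'\in\mathcal Q(p)$ with $q'\subseteq q$. - $\mathcal Q$ has *strong availability* for a set $P$ of processes if every $p\in P$ has a complete quorum $q\in\mathcal Q(p)$. - The *followers* of $p'$ are the processes $p\in\mathcal P$ such that $p'\in q$ for some $q\in\mathcal Q(p)$. A set $X$ is *$p$-blocking* if $X\cap q\ne\emptyset$ for every $q\in\mathcal Q(p)$. **Protocol.** Each well-behaved process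 $p$ keeps flags *echoed*, *readied*, *delivered* (initially false) and, for every value $v$, sets $E(v),R(v)$ (initially empty), and reacts to its inputs as follows. 1. On a request to broadcast $v$ (at the sender): send $\mathrm{BCast}(v)$ to every process in $\mathcal P$. 2. On receiving $\mathrm{BCast}(v)$ from $s$: if not *echoed*, set *echoed* and send $\mathrm{Echo}(v)$ to all followers of $p$. ($\mathrm{BCast}$ messages from other nodes are ignored.) 3. On receiving $\mathrm{Echo}(v)$ from $p'$: add $p'$ to $E(v)$; if not *readied* and $q\subseteq E(v)$ for some $q\in\mathcal Q(p)$, set *readied* and send $\mathrm{Ready}(v)$ to all followers of $p$. 4. On receiving $\mathrm{Ready}(v)$ from $p'$: add $p'$ to $R(v)$; if not *readied* and $R(v)$ is $p$-blocking, set *readied* and send $\mathrm{Ready}(v)$ to all followers of $p$; then, if not *delivered* and $q\subseteq R(v)$ for some $q\in\mathcal Q(p)$, set *delivered* and deliver $v$. A well-behaved sender outside $\mathcal P$ only performs item 1. **Executions.** In an execution, the well-behaved nodes handle their inputs one at a time according to the protocol, and Byzantine nodes behave arbitrarily. Communication is by authenticated, reliable, asynchronous point-to-point links: a message received from a well-behaved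 node was sent by it before, and every message sent by a well-behaved node to a well-behaved process is eventually received. At most one broadcast request is issued, and it is issued at the designated sender. **Theorem.** Let $\mathcal Q$ be a heterogeneous quorum system that has quorum intersection, and let $P\subseteq\mathcal W$ be a non-empty set of well-behaved processes for which $\mathcal Q$ has strong availability. Then the above protocol implements Byzantine reliable broadcast: every execution satisfies - *Validity for $P$:* if a well-behaved sender broadcasts $m$, then every process in $P$ eventually delivers $m$; - *Integrity:* if a well-behaved process delivers $m$ and the sender is well-behaved, then the sender previously broadcast $m$; - *Totality for $P$:* if a well-behaved process delivers a message, then every process in $P$ eventually delivers a message; - *Consistency:* no two well-behaved processes deliver different messages; - *No duplication:* every well-behaved process delivers at most one message (and at most once). -/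

import Mathlib

/-! ### Processes and heterogeneous quorum systems -/

/-- The setting of an execution of a broadcast protocol: a finite set `procs` of system
processes, the set `byz` of Byzantine nodes, and the designated sender, which is either one of the
system processes or a separate node. -/
structure BSystem (Node : Type*) where
  procs : Set Node
  finite_procs : procs.Finite
  byz : Set Node
  sender : Node

/-- The well-behaved system processes. -/
def BSystem.wellBehaved {Node : Type*} (S : BSystem Node) : Set Node :=
  S.procs \ S.byz

/-- A heterogeneous quorum system: every process has a non-empty set of individual minimal
quorums, which are non-empty sets of processes none of which properly contains another one.
The quorums of Byzantine processes are left unspecified (arbitrary). -/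
structure QuorumSystem {Node : Type*} (S : BSystem Node) where
  quorums : Node → Set (Set Node)
  nonempty : ∀ p ∈ S.wellBehaved, (quorums p).Nonempty
  quorum_nonempty : ∀ p ∈ S.wellBehaved, ∀ q ∈ quorums p, q.Nonempty
  quorum_subset : ∀ p ∈ S.wellBehaved, ∀ q ∈ quorums p, q ⊆ S.procs
  minimal : ∀ p ∈ S.wellBehaved, IsAntichain (· ⊆ ·) (quorums p)

namespace QuorumSystem

/-- Any two quorums of well-behaved processes intersect at a well-behaved process. -/
def QuorumIntersection {Node : Type*} {S : BSystem Node} (Q : QuorumSystem S) : Prop :=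
  ∀ p ∈ S.wellBehaved, ∀ p' ∈ S.wellBehaved, ∀ q ∈ Q.quorums p, ∀ q' ∈ Q.quorums p',
    (q ∩ q' ∩ S.wellBehaved).Nonempty

/-- `Q` is quorum subsuming for `q`: every process in `q` has a quorum included in `q`. -/
def QuorumSubsuming {Node : Type*} {S : BSystem Node} (Q : QuorumSystem S) (q : Set Node) : Prop :=
  ∀ p ∈ q, ∃ q' ∈ Q.quorums p, q' ⊆ q

/-- A quorum is complete if all its members are well-behaved and `Q` is quorum subsuming for it. -/
def IsComplete {Node : Type*} {S : BSystem Node} (Q : QuorumSystem S) (q : Set Node) : Prop :=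
  q ⊆ S.wellBehaved ∧ Q.QuorumSubsuming q

/-- Strong availability for `P`: every process in `P` has at least one complete quorum. -/
def StrongAvailability {Node : Type*} {S : BSystem Node} (Q : QuorumSystem S) (P : Set Node) :
    Prop :=
  ∀ p ∈ P, ∃ q ∈ Q.quorums p, Q.IsComplete q

/-- The followers of `p'`: the processes that have a quorum containing `p'`. -/
def followers {Node : Type*} {S : BSystem Node} (Q : QuorumSystem S) (p' : Node) : Set Node :=
  {p ∈ S.procs | ∃ q ∈ Q.quorums p, p' ∈ q}

end QuorumSystem

/-- `X` is a blocking set for a process whose individual minimal quorums are `Qs`: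
it intersects every quorum. -/
def IsBlocking {Node : Type*} (Qs : Set (Set Node)) (X : Set Node) : Prop :=
  ∀ q ∈ Qs, (X ∩ q).Nonempty

/-! ### Protocol components and their executions -/

/-- Inputs of a component on top of point-to-point links: a request of its user,
or the receipt of a message together with the identity of the node that sent it. -/
inductive BInput (Node Req Msg : Type*) where
  | request (r : Req)
  | receive (src : Node) (m : Msg)

/-- Outputs of a component: a message to be sent, or a response to its user. -/
inductive BOutput (Node Resp Msg : Type*) where
  | send (dst : Node) (m : Msg)
  | response (r : Resp)

/-- A (deterministic) component: an initial local state, and a handler which maps the current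
local state and an input to the next local state and the outputs. -/
structure Component (Node Req Resp Msg State : Type*) where
  init : State
  handle : State → BInput Node Req Msg → State × Set (BOutput Node Resp Msg)

section Runs

variable {Node Req Resp Msg State : Type*}

open Classical in
/-- The local state of node `p` before step `t`, if node `p` runs the component `C p` and
`ev t = some (p, i)` says that at step `t` node `p` handles the input `i`. -/
noncomputable def localState (C : Node → Component Node Req Resp Msg State)
    (ev : ℕ → Option (Node × BInput Node Req Msg)) : ℕ → Node → State
  | 0, p => (C p).init
  | t + 1, p =>
    match ev t with
    | some (p', i) =>
      if p' = p then ((C p).handle (localState C ev t p) i).1 else localState C ev t p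
    | none => localState C ev t p

/-- Node `p` produces the output `o` at step `t`. -/
def HasOutput (C : Node → Component Node Req Resp Msg State)
    (ev : ℕ → Option (Node × BInput Node Req Msg)) (t : ℕ) (p : Node)
    (o : BOutput Node Resp Msg) : Prop :=
  ∃ i, ev t = some (p, i) ∧ o ∈ ((C p).handle (localState C ev t p) i).2

/-- An infinite execution in which the well-behaved nodes run the components `C`. Each step is
either the handling of one input by a well-behaved node, or `none` (nothing visible to the
well-behaved nodes happens). Byzantine nodes are unrestricted: messages from a Byzantine source may
be received at any time, with any content. Links are authenticated and reliable: a message that is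
received from a well-behaved source was sent by it before, and a message between well-behaved nodes
is eventually received, with no bound on the delay. The user issues at most one request, at the
designated sender. -/
structure Execution (S : BSystem Node) (C : Node → Component Node Req Resp Msg State) where
  event : ℕ → Option (Node × BInput Node Req Msg)
  receive_at : ∀ t p src m, event t = some (p, .receive src m) → p ∈ S.wellBehaved
  request_at : ∀ t p r, event t = some (p, .request r) → p = S.sender ∧ p ∉ S.byz
  request_once : ∀ t t' p p' r r', event t = some (p, .request r) →
    event t' = some (p', .request r') → t = t'
  authentic : ∀ t p src m, event t = some (p, .receive src m) → src ∉ S.byz →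
    ∃ t' < t, HasOutput C event t' src (.send p m)
  reliable : ∀ t src dst m, src ∉ S.byz → dst ∈ S.wellBehaved →
    HasOutput C event t src (.send dst m) → ∃ t' > t, event t' = some (dst, .receive src m)

end Runs

/-! ### Specification of Byzantine reliable broadcast -/

namespace Execution

variable {Node V Msg State : Type*} {S : BSystem Node} {C : Node → Component Node V V Msg State}

/-- At step `t`, the well-behaved sender handles the request to broadcast `m`. -/
def Broadcasts (x : Execution S C) (t : ℕ) (m : V) : Prop :=
  x.event t = some (S.sender, .request m)

/-- At step `t`, process `p` delivers `m`. -/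
def Delivers (x : Execution S C) (t : ℕ) (p : Node) (m : V) : Prop :=
  HasOutput C x.event t p (.response m)

/-- If a well-behaved sender broadcasts `m`, then every process in `P` eventually delivers `m`. -/
def Validity (x : Execution S C) (P : Set Node) : Prop :=
  S.sender ∉ S.byz → ∀ t m, x.Broadcasts t m → ∀ p ∈ P, ∃ t' > t, x.Delivers t' p m

/-- If a well-behaved process delivers `m` and the sender is well-behaved, then the sender
broadcast `m` before. -/
def Integrity (x : Execution S C) : Prop :=
  S.sender ∉ S.byz → ∀ p ∈ S.wellBehaved, ∀ t m, x.Delivers t p m → ∃ t' < t, x.Broadcasts t' m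

/-- If some well-behaved process delivers a message, then every process in `P` delivers a message
at some time. -/
def Totality (x : Execution S C) (P : Set Node) : Prop :=
  (∃ p ∈ S.wellBehaved, ∃ t m, x.Delivers t p m) → ∀ p ∈ P, ∃ t m, x.Delivers t p m

/-- No two well-behaved processes deliver different messages. -/
def Consistency (x : Execution S C) : Prop :=
  ∀ p ∈ S.wellBehaved, ∀ p' ∈ S.wellBehaved, ∀ t t' m m',
    x.Delivers t p m → x.Delivers t' p' m' → m = m'

/-- Every well-behaved process delivers at most one message, at most once. -/
def NoDuplication (x : Execution S C) : Prop :=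
  ∀ p ∈ S.wellBehaved, ∀ t t' m m', x.Delivers t p m → x.Delivers t' p m' → t = t' ∧ m = m'

end Execution

/-- The protocol `C` implements Byzantine reliable broadcast in `S`, with validity and totality
for the set `P`: every execution has the required properties. -/
def ImplementsBRB {Node V Msg State : Type*} (S : BSystem Node)
    (C : Node → Component Node V V Msg State) (P : Set Node) : Prop :=
  ∀ x : Execution S C,
    x.Validity P ∧ x.Integrity ∧ x.Totality P ∧ x.Consistency ∧ x.NoDuplication

/-! ### The Bracha-style protocol for heterogeneous quorum systems -/

/-- Messages of the protocol. -/
inductive BrachaMsg (V : Type*) where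
  | bcast (v : V)
  | echo (v : V)
  | ready (v : V)

/-- Local state: the flags, and for every value the sets of processes from which an echo,
respectively a ready message for that value was received. -/
structure BrachaState (Node V : Type*) where
  echoed : Bool
  readied : Bool
  delivered : Bool
  E : V → Set Node
  R : V → Set Node

/-- The outputs that send `m` to every node in `D`. -/
def sendAll {Node V : Type*} (D : Set Node) (m : BrachaMsg V) :
    Set (BOutput Node V (BrachaMsg V)) :=
  {o | ∃ p ∈ D, o = .send p m}

open Classical in
/-- The component of a process which knows the set `procs` of all processes, the identity of the
sender, its own individual minimal quorums `Qs` and its followers `F`. -/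
noncomputable def brachaComponent {Node : Type*} (V : Type*) (procs : Set Node) (sender : Node)
    (Qs : Set (Set Node)) (F : Set Node) :
    Component Node V V (BrachaMsg V) (BrachaState Node V) where
  init := ⟨false, false, false, fun _ => ∅, fun _ => ∅⟩
  handle st
    | .request v => (st, sendAll procs (.bcast v))
    | .receive p' (.bcast v) =>
      if p' = sender ∧ st.echoed = false then
        ({ st with echoed := true }, sendAll F (.echo v))
      else (st, ∅)
    | .receive p' (.echo v) =>
      let st₁ := { st with E := Function.update st.E v (st.E v ∪ {p'}) }
      if st₁.readied = false ∧ ∃ q ∈ Qs, q ⊆ st₁.E v then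
        ({ st₁ with readied := true }, sendAll F (.ready v))
      else (st₁, ∅)
    | .receive p' (.ready v) =>
      let st₁ := { st with R := Function.update st.R v (st.R v ∪ {p'}) }
      let r : BrachaState Node V × Set (BOutput Node V (BrachaMsg V)) :=
        if st₁.readied = false ∧ IsBlocking Qs (st₁.R v) then
          ({ st₁ with readied := true }, sendAll F (.ready v))
        else (st₁, ∅)
      if r.1.delivered = false ∧ ∃ q ∈ Qs, q ⊆ r.1.R v then
        ({ r.1 with delivered := true }, r.2 ∪ {.response v})
      else r

/-- The protocol: every process runs the component with its own quorums and followers. -/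
noncomputable def QuorumSystem.bracha {Node : Type*} {S : BSystem Node} (Q : QuorumSystem S)
    (V : Type*) (p : Node) : Component Node V V (BrachaMsg V) (BrachaState Node V) :=
  brachaComponent V S.procs S.sender (Q.quorums p) (Q.followers p)

/-!
A process echoes only once and readies only once, and any two quorums share a well-behaved process.
Hence quorums of echoes for two values, or quorums of ready messages for two values, force the
values to be equal: this gives consistency.

If some member of a complete quorum readies `v`, consider the first one to do so. A blocking set of
ready messages would contain an earlier ready message from inside the complete quorum, so the first
member has seen a quorum of echoes for `v`. Since a quorum of ready messages meets every complete
quorum, a delivered value is backed by a quorum of echoes too. This gives integrity, because a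
well-behaved process echoes only what it received from the sender, and it shows that all members of
complete quorums ready the delivered value, if they ready at all.

They do ready: by quorum intersection, the well-behaved part of a quorum blocks every well-behaved
process, so one delivery eventually makes every well-behaved process ready; for validity, the echoes
of the well-behaved processes already suffice. A process with a complete quorum then receives ready
messages for the same value from all of that quorum and delivers.
-/

section Runs

variable {Node Req Resp Msg State : Type*} {C : Node → Component Node Req Resp Msg State}
  {ev : ℕ → Option (Node × BInput Node Req Msg)} {t t' : ℕ} {p : Node}

theorem localState_succ {i : BInput Node Req Msg} (h : ev t = some (p, i)) :
    localState C ev (t + 1) p = ((C p).handle (localState C ev t p) i).1 := by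
  simp [localState, h]

theorem localState_succ_of_forall_ne (h : ∀ i, ev t ≠ some (p, i)) :
    localState C ev (t + 1) p = localState C ev t p := by
  rw [localState]
  split
  · rename_i p' i heq
    exact if_neg fun hp => h i (heq.trans (by rw [hp]))
  · rfl

/-- At step `t`, node `p` handles an input which is related by `A` to its local state. This is how
an action of `p` is described by its guard `A` alone, whether or not it produces an output. -/
def FiresAt (C : Node → Component Node Req Resp Msg State)
    (ev : ℕ → Option (Node × BInput Node Req Msg)) (t : ℕ) (p : Node)
    (A : State → BInput Node Req Msg → Prop) : Prop :=
  ∃ i, ev t = some (p, i) ∧ A (localState C ev t p) i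

theorem localState_iff_exists_firesAt {φ : State → Prop} {A : State → BInput Node Req Msg → Prop}
    (hinit : ¬ φ (C p).init) (hstep : ∀ st i, φ ((C p).handle st i).1 ↔ φ st ∨ A st i) (t : ℕ) :
    φ (localState C ev t p) ↔ ∃ t' < t, FiresAt C ev t' p A := by
  induction t with
  | zero => simpa [localState] using hinit
  | succ t ih =>
    have hlocal : φ (localState C ev (t + 1) p) ↔
        φ (localState C ev t p) ∨ FiresAt C ev t p A := by
      by_cases h : ∃ i, ev t = some (p, i)
      · obtain ⟨i, hi⟩ := h
        simp [localState_succ hi, hstep, FiresAt, hi]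
      · push Not at h
        simp [localState_succ_of_forall_ne h, FiresAt, h]
    rw [hlocal, ih, Nat.exists_lt_succ_right]

namespace Component

/-- The Boolean `flag` makes the actions with guards `A a` one-shot: it is initially false, it is
raised by these actions and by nothing else, it disables them, and an input triggers at most one of
them. -/
structure IsOneShot {α : Type*} (c : Component Node Req Resp Msg State) (flag : State → Bool)
    (A : α → State → BInput Node Req Msg → Prop) : Prop where
  init : flag c.init = false
  handle_iff : ∀ st i, flag (c.handle st i).1 = true ↔ flag st = true ∨ ∃ a, A a st i
  disabled : ∀ ⦃a st i⦄, A a st i → flag st = false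
  label_unique : ∀ ⦃a a' st i⦄, A a st i → A a' st i → a = a'

namespace IsOneShot

variable {α : Type*} {flag : State → Bool} {A : α → State → BInput Node Req Msg → Prop} {a a' : α}

theorem flag_iff_exists_firesAt (h : (C p).IsOneShot flag A) (t : ℕ) :
    flag (localState C ev t p) = true ↔ ∃ t' < t, ∃ a, FiresAt C ev t' p (A a) := by
  rw [localState_iff_exists_firesAt (φ := (flag · = true)) (by simp [h.init]) h.handle_iff]
  simp only [FiresAt, exists_and_left, exists_comm (α := α)]

theorem le (h : (C p).IsOneShot flag A) (hfire : FiresAt C ev t p (A a))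
    (hfire' : FiresAt C ev t' p (A a')) : t' ≤ t := by
  by_contra! hlt
  obtain ⟨_, -, hA⟩ := hfire'
  have hraised := (h.flag_iff_exists_firesAt t').2 ⟨t, hlt, a, hfire⟩
  exact Bool.false_ne_true ((h.disabled hA).symm.trans hraised)

theorem unique (h : (C p).IsOneShot flag A) (hfire : FiresAt C ev t p (A a))
    (hfire' : FiresAt C ev t' p (A a')) : t = t' ∧ a = a' := by
  obtain rfl : t = t' :=
    le_antisymm (h.le hfire' hfire) (h.le hfire hfire')
  obtain ⟨i, hi, hA⟩ := hfire
  obtain ⟨i', hi', hA'⟩ := hfire'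
  obtain rfl : i = i' := by simpa [hi] using hi'
  exact ⟨rfl, h.label_unique hA hA'⟩

theorem exists_firesAt_of_enabled (h : (C p).IsOneShot flag A)
    (henabled : flag (localState C ev t p) = false → FiresAt C ev t p (A a)) :
    ∃ t a, FiresAt C ev t p (A a) := by
  cases hflag : flag (localState C ev t p) with
  | false => exact ⟨t, a, henabled hflag⟩
  | true =>
    obtain ⟨t', -, hfire⟩ := (h.flag_iff_exists_firesAt t).1 hflag
    exact ⟨t', hfire⟩

end IsOneShot

end Component

/-- The nodes from which `p` received the message `m` before step `t`. -/
def receivedFrom (ev : ℕ → Option (Node × BInput Node Req Msg)) (t : ℕ) (p : Node) (m : Msg) :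
    Set Node :=
  {src | ∃ t' < t, ev t' = some (p, .receive src m)}

theorem receivedFrom_succ {src : Node} {m : Msg} (h : ev t = some (p, .receive src m)) :
    receivedFrom ev (t + 1) p m = insert src (receivedFrom ev t p m) := by
  ext src'
  simp only [receivedFrom, Nat.exists_lt_succ_right, h]
  simp [or_comm, eq_comm]

theorem Execution.exists_last_receive {S : BSystem Node} (x : Execution S C) {X : Set Node}
    (hX : X ⊆ S.wellBehaved) (hne : X.Nonempty) (hp : p ∈ S.wellBehaved) {m : Msg}
    (hsend : ∀ src ∈ X, ∃ t, HasOutput C x.event t src (.send p m)) :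
    ∃ t src, x.event t = some (p, .receive src m) ∧ X ⊆ receivedFrom x.event (t + 1) p m := by
  have hreceive : ∀ src ∈ X, ∃ t, x.event t = some (p, .receive src m) := fun src hsrc => by
    obtain ⟨t, ht⟩ := hsend src hsrc
    obtain ⟨t', -, ht'⟩ := x.reliable t src p m (hX hsrc).2 hp ht
    exact ⟨t', ht'⟩
  choose! time htime using hreceive
  have hfinite : X.Finite := S.finite_procs.subset (hX.trans Set.sdiff_subset)
  obtain ⟨last, hlast, hmax⟩ := hfinite.exists_maximalFor time X hne
  have hle : ∀ src ∈ X, time src ≤ time last := fun src hsrc =>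
    (le_total (time src) (time last)).elim id (hmax hsrc)
  exact ⟨time last, last, htime last hlast, fun src hsrc =>
    ⟨time src, Nat.lt_succ_of_le (hle src hsrc), htime src hsrc⟩⟩

end Runs

/-! ### The guards of the protocol -/

namespace BrachaState

variable {Node V : Type*}

/-- The input `i` makes a process in state `st` echo `v`. -/
def EchoGuard (sender : Node) (v : V) (st : BrachaState Node V)
    (i : BInput Node V (BrachaMsg V)) : Prop :=
  st.echoed = false ∧ i = .receive sender (.bcast v)

/-- The input `i` makes a process with quorums `Qs` in state `st` send ready messages for `v`. The
node that the input comes from is counted as a member of `E v` or `R v` already. -/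
def ReadyGuard (Qs : Set (Set Node)) (v : V) (st : BrachaState Node V)
    (i : BInput Node V (BrachaMsg V)) : Prop :=
  st.readied = false ∧ ∃ src,
    (i = .receive src (.echo v) ∧ ∃ q ∈ Qs, q ⊆ insert src (st.E v)) ∨
    (i = .receive src (.ready v) ∧ IsBlocking Qs (insert src (st.R v)))

/-- The input `i` makes a process with quorums `Qs` in state `st` deliver `v`. -/
def DeliverGuard (Qs : Set (Set Node)) (v : V) (st : BrachaState Node V)
    (i : BInput Node V (BrachaMsg V)) : Prop :=
  st.delivered = false ∧ ∃ src, i = .receive src (.ready v) ∧ ∃ q ∈ Qs, q ⊆ insert src (st.R v)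

end BrachaState

namespace brachaComponent

open BrachaState

variable {Node V : Type*} {procs : Set Node} {sender : Node} {Qs : Set (Set Node)} {F : Set Node}
  {st : BrachaState Node V} {i : BInput Node V (BrachaMsg V)} {d src : Node} {v : V}

@[simp]
theorem handle_request :
    (brachaComponent V procs sender Qs F).handle st (.request v) =
      (st, sendAll procs (.bcast v)) := rfl

open Classical in
@[simp]
theorem handle_bcast :
    (brachaComponent V procs sender Qs F).handle st (.receive src (.bcast v)) =
      ({ st with echoed := st.echoed || decide (src = sender) },
        {o | (st.echoed = false ∧ src = sender) ∧ o ∈ sendAll F (.echo v)}) := by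
  obtain ⟨echoed, readied, delivered, E, R⟩ := st
  by_cases hsrc : src = sender <;> cases echoed <;> simp [brachaComponent, hsrc]

open Classical in
@[simp]
theorem handle_echo :
    (brachaComponent V procs sender Qs F).handle st (.receive src (.echo v)) =
      ({ st with
          E := Function.update st.E v (insert src (st.E v))
          readied := st.readied || decide (∃ q ∈ Qs, q ⊆ insert src (st.E v)) },
        {o | (st.readied = false ∧ ∃ q ∈ Qs, q ⊆ insert src (st.E v)) ∧
          o ∈ sendAll F (.ready v)}) := by
  obtain ⟨echoed, readied, delivered, E, R⟩ := st
  simp only [brachaComponent, Function.update_self, Set.union_singleton]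
  by_cases hquorum : ∃ q ∈ Qs, q ⊆ insert src (E v) <;> cases readied <;>
    simp only [hquorum] <;> simp

open Classical in
@[simp]
theorem handle_ready :
    (brachaComponent V procs sender Qs F).handle st (.receive src (.ready v)) =
      ({ st with
          R := Function.update st.R v (insert src (st.R v))
          readied := st.readied || decide (IsBlocking Qs (insert src (st.R v)))
          delivered := st.delivered || decide (∃ q ∈ Qs, q ⊆ insert src (st.R v)) },
        {o | (st.readied = false ∧ IsBlocking Qs (insert src (st.R v))) ∧
            o ∈ sendAll F (.ready v) ∨
          (st.delivered = false ∧ ∃ q ∈ Qs, q ⊆ insert src (st.R v)) ∧ o = .response v}) := by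
  obtain ⟨echoed, readied, delivered, E, R⟩ := st
  simp only [brachaComponent, Function.update_self, Set.union_singleton]
  generalize insert src (R v) = X
  by_cases hquorum : ∃ q ∈ Qs, q ⊆ X <;> by_cases hblocking : IsBlocking Qs X <;>
    cases readied <;> cases delivered <;> simp [hquorum, hblocking, Set.insert_def, or_comm]

theorem send_bcast_mem_handle_iff :
    .send d (.bcast v) ∈ ((brachaComponent V procs sender Qs F).handle st i).2 ↔
      i = .request v ∧ d ∈ procs := by
  rcases i with w | ⟨src, w | w | w⟩ <;> by_cases hwv : w = v <;>
    simp_all [sendAll, eq_comm (a := v)]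

theorem send_echo_mem_handle_iff :
    .send d (.echo v) ∈ ((brachaComponent V procs sender Qs F).handle st i).2 ↔
      st.EchoGuard sender v i ∧ d ∈ F := by
  rcases i with w | ⟨src, w | w | w⟩ <;> by_cases hwv : w = v <;>
    simp_all [sendAll, EchoGuard, eq_comm (a := v)]

theorem send_ready_mem_handle_iff :
    .send d (.ready v) ∈ ((brachaComponent V procs sender Qs F).handle st i).2 ↔
      st.ReadyGuard Qs v i ∧ d ∈ F := by
  rcases i with w | ⟨src, w | w | w⟩ <;> by_cases hwv : w = v <;>
    simp_all [sendAll, ReadyGuard, eq_comm (a := v)]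

theorem response_mem_handle_iff :
    .response v ∈ ((brachaComponent V procs sender Qs F).handle st i).2 ↔
      st.DeliverGuard Qs v i := by
  rcases i with w | ⟨src, w | w | w⟩ <;> by_cases hwv : w = v <;>
    simp_all [sendAll, DeliverGuard, eq_comm (a := v)]

theorem mem_handle_E_iff :
    src ∈ ((brachaComponent V procs sender Qs F).handle st i).1.E v ↔
      src ∈ st.E v ∨ i = .receive src (.echo v) := by
  rcases i with w | ⟨src', w | w | w⟩ <;> by_cases hwv : w = v <;>
    simp_all [or_comm, eq_comm (a := v), eq_comm (a := src)]

theorem mem_handle_R_iff :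
    src ∈ ((brachaComponent V procs sender Qs F).handle st i).1.R v ↔
      src ∈ st.R v ∨ i = .receive src (.ready v) := by
  rcases i with w | ⟨src', w | w | w⟩ <;> by_cases hwv : w = v <;>
    simp_all [or_comm, eq_comm (a := v), eq_comm (a := src)]

theorem isOneShot_echoed :
    (brachaComponent V procs sender Qs F).IsOneShot BrachaState.echoed (EchoGuard sender) where
  init := rfl
  handle_iff st i := by
    rcases i with w | ⟨src, w | w | w⟩ <;> cases hflag : st.echoed <;>
      simp [EchoGuard, hflag]
  disabled _ _ _ h := h.1
  label_unique _ _ _ _ h h' := by simpa using h.2.symm.trans h'.2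

theorem isOneShot_readied :
    (brachaComponent V procs sender Qs F).IsOneShot BrachaState.readied (ReadyGuard Qs) where
  init := rfl
  handle_iff st i := by
    rcases i with w | ⟨src, w | w | w⟩ <;> cases hflag : st.readied <;>
      simp [ReadyGuard, hflag]
  disabled _ _ _ h := h.1
  label_unique _ _ _ _ h h' := by grind [ReadyGuard]

theorem isOneShot_delivered :
    (brachaComponent V procs sender Qs F).IsOneShot BrachaState.delivered (DeliverGuard Qs) where
  init := rfl
  handle_iff st i := by
    rcases i with w | ⟨src, w | w | w⟩ <;> cases hflag : st.delivered <;>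
      simp [DeliverGuard, hflag]
  disabled _ _ _ h := h.1
  label_unique _ _ _ _ h h' := by grind [DeliverGuard]

end brachaComponent

namespace QuorumSystem

variable {Node V : Type*} {S : BSystem Node} {Q : QuorumSystem S} {A B : Set Node} {p : Node}

/-- `A` contains the well-behaved members of some quorum of a well-behaved process. The Byzantine
members are exempt because what they send and do is not observable. -/
def ContainsQuorum (Q : QuorumSystem S) (A : Set Node) : Prop :=
  ∃ p ∈ S.wellBehaved, ∃ q ∈ Q.quorums p, q ∩ S.wellBehaved ⊆ A

theorem ContainsQuorum.mono (hA : Q.ContainsQuorum A) (hAB : A ⊆ B) : Q.ContainsQuorum B := by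
  obtain ⟨p, hp, q, hq, hqA⟩ := hA
  exact ⟨p, hp, q, hq, hqA.trans hAB⟩

theorem QuorumIntersection.isBlocking (hQI : Q.QuorumIntersection) (hA : Q.ContainsQuorum A)
    (hp : p ∈ S.wellBehaved) : IsBlocking (Q.quorums p) (A ∩ S.wellBehaved) := by
  intro q hq
  obtain ⟨p', hp', q', hq', hq'A⟩ := hA
  obtain ⟨a, ⟨haq', haq⟩, haW⟩ := hQI p' hp' p hp q' hq' q hq
  exact ⟨a, ⟨hq'A ⟨haq', haW⟩, haW⟩, haq⟩

theorem QuorumIntersection.inter_nonempty (hQI : Q.QuorumIntersection) (hA : Q.ContainsQuorum A)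
    (hB : Q.ContainsQuorum B) : (A ∩ B ∩ S.wellBehaved).Nonempty := by
  obtain ⟨p, hp, q, hq, hqB⟩ := hB
  obtain ⟨a, ⟨haA, haW⟩, haq⟩ := hQI.isBlocking hA hp q hq
  exact ⟨a, ⟨haA, hqB ⟨haq, haW⟩⟩, haW⟩

variable {ev : ℕ → Option (Node × BInput Node V (BrachaMsg V))}

theorem localState_bracha_E (t : ℕ) (v : V) :
    (localState (Q.bracha V) ev t p).E v = receivedFrom ev t p (.echo v) := by
  ext src
  exact (localState_iff_exists_firesAt (C := Q.bracha V)
    (φ := fun st : BrachaState Node V => src ∈ st.E v) (Set.notMem_empty src)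
    (fun _ _ => brachaComponent.mem_handle_E_iff) t).trans (by simp [FiresAt, receivedFrom])

theorem localState_bracha_R (t : ℕ) (v : V) :
    (localState (Q.bracha V) ev t p).R v = receivedFrom ev t p (.ready v) := by
  ext src
  exact (localState_iff_exists_firesAt (C := Q.bracha V)
    (φ := fun st : BrachaState Node V => src ∈ st.R v) (Set.notMem_empty src)
    (fun _ _ => brachaComponent.mem_handle_R_iff) t).trans (by simp [FiresAt, receivedFrom])

end QuorumSystem

namespace Execution

open QuorumSystem

section Broadcasts

variable {Node V Msg State : Type*} {S : BSystem Node} {C : Node → Component Node V V Msg State}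
  {x : Execution S C} {t t' : ℕ} {v v' : V}

theorem Broadcasts.unique (h : x.Broadcasts t v) (h' : x.Broadcasts t' v') : t = t' ∧ v = v' := by
  obtain rfl := x.request_once _ _ _ _ _ _ h h'
  simpa using (Eq.symm h).trans h'

end Broadcasts

variable {Node V : Type*} {S : BSystem Node} {Q : QuorumSystem S}
  {x : Execution S (Q.bracha V)} {v v' : V} {t t' : ℕ} {p d : Node} {q : Set Node}

/-- At step `t`, process `p` sends an echo for `v` to its followers. -/
def EchoesAt (x : Execution S (Q.bracha V)) (t : ℕ) (p : Node) (v : V) : Prop :=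
  FiresAt (Q.bracha V) x.event t p (BrachaState.EchoGuard S.sender v)

/-- At step `t`, process `p` sends a ready message for `v` to its followers. -/
def ReadiesAt (x : Execution S (Q.bracha V)) (t : ℕ) (p : Node) (v : V) : Prop :=
  FiresAt (Q.bracha V) x.event t p (BrachaState.ReadyGuard (Q.quorums p) v)

/-- The processes that have echoed `v` before step `t`. -/
def echoers (x : Execution S (Q.bracha V)) (v : V) (t : ℕ) : Set Node :=
  {p | ∃ s < t, x.EchoesAt s p v}

/-- The processes that have sent ready messages for `v` before step `t`. -/
def readiers (x : Execution S (Q.bracha V)) (v : V) (t : ℕ) : Set Node :=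
  {p | ∃ s < t, x.ReadiesAt s p v}

theorem echoers_mono (x : Execution S (Q.bracha V)) (v : V) : Monotone (x.echoers v) :=
  fun _ _ hle _ ⟨t', hlt, h⟩ => ⟨t', hlt.trans_le hle, h⟩

theorem hasOutput_send_bcast_iff :
    HasOutput (Q.bracha V) x.event t p (.send d (.bcast v)) ↔
      x.event t = some (p, .request v) ∧ d ∈ S.procs := by
  simp [HasOutput, bracha, brachaComponent.send_bcast_mem_handle_iff]

theorem hasOutput_send_echo_iff :
    HasOutput (Q.bracha V) x.event t p (.send d (.echo v)) ↔
      x.EchoesAt t p v ∧ d ∈ Q.followers p := by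
  simp only [HasOutput, EchoesAt, FiresAt, bracha, brachaComponent.send_echo_mem_handle_iff,
    ← and_assoc, exists_and_right]

theorem hasOutput_send_ready_iff :
    HasOutput (Q.bracha V) x.event t p (.send d (.ready v)) ↔
      x.ReadiesAt t p v ∧ d ∈ Q.followers p := by
  simp only [HasOutput, ReadiesAt, FiresAt, bracha, brachaComponent.send_ready_mem_handle_iff,
    ← and_assoc, exists_and_right]

theorem delivers_iff_firesAt :
    x.Delivers t p v ↔
      FiresAt (Q.bracha V) x.event t p (BrachaState.DeliverGuard (Q.quorums p) v) := by
  simp only [Delivers, HasOutput, FiresAt, bracha, brachaComponent.response_mem_handle_iff]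

theorem readiesAt_iff :
    x.ReadiesAt t p v ↔ (localState (Q.bracha V) x.event t p).readied = false ∧ ∃ src,
      (x.event t = some (p, .receive src (.echo v)) ∧
        ∃ q ∈ Q.quorums p, q ⊆ receivedFrom x.event (t + 1) p (.echo v)) ∨
      (x.event t = some (p, .receive src (.ready v)) ∧
        IsBlocking (Q.quorums p) (receivedFrom x.event (t + 1) p (.ready v))) := by
  constructor
  · rintro ⟨_, hevent, hflag, src, ⟨rfl, h⟩ | ⟨rfl, h⟩⟩
    · rw [localState_bracha_E, ← receivedFrom_succ hevent] at h
      exact ⟨hflag, src, .inl ⟨hevent, h⟩⟩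
    · rw [localState_bracha_R, ← receivedFrom_succ hevent] at h
      exact ⟨hflag, src, .inr ⟨hevent, h⟩⟩
  · rintro ⟨hflag, src, ⟨hevent, h⟩ | ⟨hevent, h⟩⟩
    · rw [receivedFrom_succ hevent, ← localState_bracha_E] at h
      exact ⟨_, hevent, hflag, src, .inl ⟨rfl, h⟩⟩
    · rw [receivedFrom_succ hevent, ← localState_bracha_R] at h
      exact ⟨_, hevent, hflag, src, .inr ⟨rfl, h⟩⟩

theorem delivers_iff :
    x.Delivers t p v ↔ (localState (Q.bracha V) x.event t p).delivered = false ∧ ∃ src,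
      x.event t = some (p, .receive src (.ready v)) ∧
        ∃ q ∈ Q.quorums p, q ⊆ receivedFrom x.event (t + 1) p (.ready v) := by
  rw [delivers_iff_firesAt]
  constructor
  · rintro ⟨_, hevent, hflag, src, rfl, h⟩
    rw [localState_bracha_R, ← receivedFrom_succ hevent] at h
    exact ⟨hflag, src, hevent, h⟩
  · rintro ⟨hflag, src, hevent, h⟩
    rw [receivedFrom_succ hevent, ← localState_bracha_R] at h
    exact ⟨_, hevent, hflag, src, rfl, h⟩

theorem EchoesAt.unique (h : x.EchoesAt t p v) (h' : x.EchoesAt t' p v') : v = v' :=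
  (brachaComponent.isOneShot_echoed.unique h h').2

theorem ReadiesAt.unique (h : x.ReadiesAt t p v) (h' : x.ReadiesAt t' p v') : v = v' :=
  (brachaComponent.isOneShot_readied.unique h h').2

theorem EchoesAt.exists_broadcasts (h : x.EchoesAt t p v) (hs : S.sender ∉ S.byz) :
    ∃ t' < t, x.Broadcasts t' v := by
  obtain ⟨_, hevent, -, rfl⟩ := h
  obtain ⟨t', ht', hsend⟩ := x.authentic _ _ _ _ hevent hs
  exact ⟨t', ht', (hasOutput_send_bcast_iff.1 hsend).1⟩

theorem receivedFrom_echo_inter_wellBehaved_subset :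
    receivedFrom x.event (t + 1) p (.echo v) ∩ S.wellBehaved ⊆ x.echoers v t := by
  rintro src ⟨⟨t₁, ht₁, hreceive⟩, hsrc⟩
  obtain ⟨t₂, ht₂, hsend⟩ := x.authentic _ _ _ _ hreceive hsrc.2
  exact ⟨t₂, by omega, (hasOutput_send_echo_iff.1 hsend).1⟩

theorem receivedFrom_ready_inter_wellBehaved_subset :
    receivedFrom x.event (t + 1) p (.ready v) ∩ S.wellBehaved ⊆ x.readiers v t := by
  rintro src ⟨⟨t₁, ht₁, hreceive⟩, hsrc⟩
  obtain ⟨t₂, ht₂, hsend⟩ := x.authentic _ _ _ _ hreceive hsrc.2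
  exact ⟨t₂, by omega, (hasOutput_send_ready_iff.1 hsend).1⟩

/-! ### Safety -/

theorem Delivers.containsQuorum_readiers (h : x.Delivers t p v) :
    Q.ContainsQuorum (x.readiers v t) := by
  obtain ⟨-, src, hevent, q, hq, hreceived⟩ := delivers_iff.1 h
  exact ⟨p, x.receive_at _ _ _ _ hevent, q, hq,
    (Set.inter_subset_inter_left _ hreceived).trans receivedFrom_ready_inter_wellBehaved_subset⟩

/-- The blocking rule alone never starts the ready messages inside a complete quorum: a member that
readies because of a blocking set heard an earlier ready message from another member. -/
theorem containsQuorum_echoers_of_mem_readiers (hq : Q.IsComplete q) (hp : p ∈ q)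
    (hready : p ∈ x.readiers v t) : Q.ContainsQuorum (x.echoers v t) := by
  induction t using Nat.strong_induction_on generalizing p with
  | _ t ih =>
    obtain ⟨t', hlt, hready⟩ := hready
    refine ContainsQuorum.mono ?_ (x.echoers_mono v hlt.le)
    obtain ⟨-, src, ⟨-, q', hq', hreceived⟩ | ⟨-, hblocking⟩⟩ := readiesAt_iff.1 hready
    · exact ⟨p, hq.1 hp, q', hq', (Set.inter_subset_inter_left _ hreceived).trans
        receivedFrom_echo_inter_wellBehaved_subset⟩
    · obtain ⟨q', hq', hsub⟩ := hq.2 p hp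
      obtain ⟨a, hreceived, ha⟩ := hblocking q' hq'
      exact ih t' hlt (hsub ha)
        (receivedFrom_ready_inter_wellBehaved_subset ⟨hreceived, hq.1 (hsub ha)⟩)

theorem containsQuorum_echoers_of_containsQuorum_readiers (hQI : Q.QuorumIntersection)
    (hp : p ∈ S.wellBehaved) (hqp : q ∈ Q.quorums p) (hq : Q.IsComplete q)
    (hready : Q.ContainsQuorum (x.readiers v t)) : Q.ContainsQuorum (x.echoers v t) := by
  obtain ⟨a, ⟨hready, -⟩, ha⟩ := hQI.isBlocking hready hp q hqp
  exact containsQuorum_echoers_of_mem_readiers hq ha hready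

theorem eq_of_containsQuorum_echoers (hQI : Q.QuorumIntersection)
    (h : Q.ContainsQuorum (x.echoers v t)) (h' : Q.ContainsQuorum (x.echoers v' t')) :
    v = v' := by
  obtain ⟨a, ⟨⟨_, -, hecho⟩, ⟨_, -, hecho'⟩⟩, -⟩ := hQI.inter_nonempty h h'
  exact hecho.unique hecho'

theorem exists_broadcasts_of_containsQuorum_echoers (hQI : Q.QuorumIntersection)
    (hs : S.sender ∉ S.byz) (h : Q.ContainsQuorum (x.echoers v t)) :
    ∃ t' < t, x.Broadcasts t' v := by
  obtain ⟨a, ⟨⟨t₁, ht₁, hecho⟩, -⟩, -⟩ := hQI.inter_nonempty h h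
  obtain ⟨t₂, ht₂, hbroadcast⟩ := hecho.exists_broadcasts hs
  exact ⟨t₂, ht₂.trans ht₁, hbroadcast⟩

theorem noDuplication_of_bracha (x : Execution S (Q.bracha V)) : x.NoDuplication :=
  fun _ _ _ _ _ _ h h' => brachaComponent.isOneShot_delivered.unique
    (delivers_iff_firesAt.1 h) (delivers_iff_firesAt.1 h')

theorem consistency_of_bracha (hQI : Q.QuorumIntersection) (x : Execution S (Q.bracha V)) :
    x.Consistency := by
  intro p _ p' _ t t' m m' h h'
  obtain ⟨a, ⟨⟨_, -, hready⟩, ⟨_, -, hready'⟩⟩, -⟩ :=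
    hQI.inter_nonempty (Delivers.containsQuorum_readiers h) (Delivers.containsQuorum_readiers h')
  exact hready.unique hready'

theorem integrity_of_bracha (hQI : Q.QuorumIntersection) (hp : p ∈ S.wellBehaved)
    (hqp : q ∈ Q.quorums p) (hq : Q.IsComplete q) (x : Execution S (Q.bracha V)) :
    x.Integrity := fun hs _ _ _ _ h =>
  exists_broadcasts_of_containsQuorum_echoers hQI hs <|
    containsQuorum_echoers_of_containsQuorum_readiers hQI hp hqp hq h.containsQuorum_readiers

/-! ### Liveness -/

theorem exists_echoesAt_of_broadcasts (hs : S.sender ∉ S.byz) (h : x.Broadcasts t v)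
    (hp : p ∈ S.wellBehaved) : ∃ t', x.EchoesAt t' p v := by
  obtain ⟨t₁, -, hreceive⟩ :=
    x.reliable t S.sender p (.bcast v) hs hp (hasOutput_send_bcast_iff.2 ⟨h, hp.1⟩)
  obtain ⟨t₂, v', hecho⟩ := brachaComponent.isOneShot_echoed.exists_firesAt_of_enabled
    (C := Q.bracha V) (a := v) fun hflag => ⟨_, hreceive, hflag, rfl⟩
  obtain ⟨t₃, -, h'⟩ := EchoesAt.exists_broadcasts hecho hs
  obtain ⟨-, rfl⟩ := h.unique h'
  exact ⟨t₂, hecho⟩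

theorem exists_readiesAt_of_echoesAt (hp : p ∈ S.wellBehaved) (hqp : q ∈ Q.quorums p)
    (hqW : q ⊆ S.wellBehaved) (hecho : ∀ a ∈ q, ∃ t, x.EchoesAt t a v) :
    ∃ t w, x.ReadiesAt t p w := by
  obtain ⟨t, src, hevent, hreceived⟩ :=
    x.exists_last_receive hqW (Q.quorum_nonempty p hp q hqp) hp (m := .echo v) fun a ha =>
      (hecho a ha).imp fun _ h => hasOutput_send_echo_iff.2 ⟨h, hp.1, q, hqp, ha⟩
  exact brachaComponent.isOneShot_readied.exists_firesAt_of_enabled (C := Q.bracha V) fun hflag =>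
    readiesAt_iff.2 ⟨hflag, src, .inl ⟨hevent, q, hqp, hreceived⟩⟩

theorem exists_readiesAt_of_isBlocking (hp : p ∈ S.wellBehaved) {X : Set Node}
    (hXW : X ⊆ S.wellBehaved) (hX : IsBlocking (Q.quorums p) X)
    (hready : ∀ a ∈ X, ∃ t, x.ReadiesAt t a v) : ∃ t w, x.ReadiesAt t p w := by
  -- Only the members of `X` of which `p` is a follower send their ready messages to `p`.
  have hblocking : IsBlocking (Q.quorums p) (X ∩ ⋃₀ Q.quorums p) := fun q hq => by
    obtain ⟨a, haX, haq⟩ := hX q hq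
    exact ⟨a, ⟨haX, q, hq, haq⟩, haq⟩
  obtain ⟨q, hq⟩ := Q.nonempty p hp
  obtain ⟨t, src, hevent, hreceived⟩ :=
    x.exists_last_receive (Set.inter_subset_left.trans hXW) ((hblocking q hq).left) hp
      (m := .ready v) fun a ha =>
        (hready a ha.1).imp fun _ h => hasOutput_send_ready_iff.2 ⟨h, hp.1, ha.2⟩
  exact brachaComponent.isOneShot_readied.exists_firesAt_of_enabled (C := Q.bracha V) fun hflag =>
    readiesAt_iff.2 ⟨hflag, src, .inr ⟨hevent, fun q hq =>
      (hblocking q hq).mono (Set.inter_subset_inter_left q hreceived)⟩⟩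

theorem exists_delivers_of_readiesAt (hp : p ∈ S.wellBehaved) (hqp : q ∈ Q.quorums p)
    (hqW : q ⊆ S.wellBehaved) (hready : ∀ a ∈ q, ∃ t, x.ReadiesAt t a v) :
    ∃ t w, x.Delivers t p w := by
  obtain ⟨t, src, hevent, hreceived⟩ :=
    x.exists_last_receive hqW (Q.quorum_nonempty p hp q hqp) hp (m := .ready v) fun a ha =>
      (hready a ha).imp fun _ h => hasOutput_send_ready_iff.2 ⟨h, hp.1, q, hqp, ha⟩
  simp only [delivers_iff_firesAt]
  exact brachaComponent.isOneShot_delivered.exists_firesAt_of_enabled (C := Q.bracha V)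
    fun hflag => delivers_iff_firesAt.1 <|
      delivers_iff.2 ⟨hflag, src, hevent, q, hqp, hreceived⟩

theorem totality_of_bracha (hQI : Q.QuorumIntersection) {P : Set Node} (hPW : P ⊆ S.wellBehaved)
    (hSA : Q.StrongAvailability P) (x : Execution S (Q.bracha V)) : x.Totality P := by
  rintro ⟨_, _, t, m, hdeliver⟩ p hp
  obtain ⟨q, hqp, hq⟩ := hSA p hp
  have hreadiers := Delivers.containsQuorum_readiers hdeliver
  have hechoers :=
    containsQuorum_echoers_of_containsQuorum_readiers hQI (hPW hp) hqp hq hreadiers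
  have hready : ∀ a ∈ q, ∃ t, x.ReadiesAt t a m := fun a ha => by
    obtain ⟨t', m', h⟩ := exists_readiesAt_of_isBlocking (x := x) (hq.1 ha)
      Set.inter_subset_right (hQI.isBlocking hreadiers (hq.1 ha))
      fun b ⟨⟨t', _, hb⟩, _⟩ => ⟨t', hb⟩
    have hechoers' := containsQuorum_echoers_of_mem_readiers hq ha ⟨t', t'.lt_succ_self, h⟩
    obtain rfl := eq_of_containsQuorum_echoers hQI hechoers hechoers'
    exact ⟨t', h⟩
  exact exists_delivers_of_readiesAt (hPW hp) hqp hq.1 hready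

theorem validity_of_bracha (hQI : Q.QuorumIntersection) {P : Set Node} (hPW : P ⊆ S.wellBehaved)
    (hSA : Q.StrongAvailability P) (x : Execution S (Q.bracha V)) : x.Validity P := by
  intro hs t m hbroadcast p hp
  obtain ⟨q, hqp, hq⟩ := hSA p hp
  have hready : ∀ a ∈ q, ∃ t, x.ReadiesAt t a m := fun a ha => by
    obtain ⟨q', hq'a, hq'q⟩ := hq.2 a ha
    obtain ⟨t', m', h⟩ := exists_readiesAt_of_echoesAt (hq.1 ha) hq'a (hq'q.trans hq.1)
      fun b hb => exists_echoesAt_of_broadcasts hs hbroadcast (hq.1 (hq'q hb))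
    obtain ⟨_, -, hbroadcast'⟩ := exists_broadcasts_of_containsQuorum_echoers hQI hs <|
      containsQuorum_echoers_of_mem_readiers hq ha ⟨t', t'.lt_succ_self, h⟩
    obtain ⟨-, rfl⟩ := hbroadcast.unique hbroadcast'
    exact ⟨t', h⟩
  obtain ⟨t', m', hdeliver⟩ := exists_delivers_of_readiesAt (hPW hp) hqp hq.1 hready
  obtain ⟨_, hlt, hbroadcast'⟩ :=
    integrity_of_bracha hQI (hPW hp) hqp hq x hs p (hPW hp) t' m' hdeliver
  obtain ⟨rfl, rfl⟩ := hbroadcast.unique hbroadcast'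
  exact ⟨t', hlt, hdeliver⟩

end Execution

theorem mainTheorem3 {Node V : Type*} (S : BSystem Node) (Q : QuorumSystem S) (P : Set Node)
    (hPne : P.Nonempty) (hPW : P ⊆ S.wellBehaved)
    (hQI : Q.QuorumIntersection) (hSA : Q.StrongAvailability P) :
    ImplementsBRB S (Q.bracha V) P := by
  intro x
  obtain ⟨p, hp⟩ := hPne
  obtain ⟨q, hqp, hq⟩ := hSA p hp
  exact ⟨x.validity_of_bracha hQI hPW hSA, x.integrity_of_bracha hQI (hPW hp) hqp hq,
    x.totality_of_bracha hQI hPW hSA, x.consistency_of_bracha hQI, x.noDuplication_of_bracha⟩
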